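/- For a finite simple graph $\Gamma$ on a vertex set $V$, let $B(\Gamma)$ be the collection of all nonempty $I\subseteq V$ such that the induced graph $\Gamma|_I$ is connected, and let the graph-associahedron $P_{B(\Gamma)}\subset\mathbb{R}^V$ be the Minkowski sum $\sum_{I\in B(\Gamma)}\mathrm{Conv}\{e_i\mid i\in I\}$. For $n\ge 0$ let $Pe^{n-1}$ (permutohedron), $As^{n-1}$ (associahedron), $Cy^{n-1}$ (cyclohedron) and $St^{n-1}$ (stellohedron) be the graph-associahedra of, respectively, the complete graph $K_n$, the path graph $L_n$, the cycle graph $C_n$ and the star graph $K_{1,n-1}$ on $n$ vertices; here $C_1$ is a single vertex, $C_2$ is a single edge, and for $n=0$ the graph is empty and the polytope is the one point of $\mathbb{R}^0$. Let $p_n,a_n,c_n,s_n$ be the numbers of vertices of $Pe^{n-1},As^{n-1},Cy^{n-1},St^{n-1}$; in particular $p_0=a_0=1$. Then $p_1=a_1=c_1=s_1=1$, and for all $n\ge 1$ \[p_n=n\,p_{n-1},\qquad a_n=\sum_{k=1}^{n}a_{k-1}a_{n-k},\qquad c_n=n\,a_{n-1},\qquad s_n=(n-1)s_{n-1}+1.\]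 Consequently, for all $n\ge 1$, \[p_n=n!,\qquad a_n=\frac{1}{n+1}\binom{2n}{n},\qquad c_n=\binom{2n-2}{n-1},\qquad s_n=(n-1)!\sum_{k=0}^{n-1}\frac{1}{k!}.\] -/

import Mathlib

open scoped Pointwise

/-- The face `Δ_I = Conv {e_i | i ∈ I}` of the standard coordinate simplex in `ℝ^V`. -/
def simplexFace {V : Type*} [DecidableEq V] (I : Finset V) : Set (V → ℝ) :=
  convexHull ℝ {x : V → ℝ | ∃ i ∈ I, x = Pi.single i 1}

/-- The polytope `P_B = ∑_{I ∈ B} Δ_I` (Minkowski sum) of a hypergraph `B` on `V`.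
It is called a nestohedron if `B` is a building set. If `V` is empty and `B` has no members,
it is the single point of `ℝ^∅`. -/
def hypergraphPolytope {V : Type*} [DecidableEq V] (B : Finset (Finset V)) : Set (V → ℝ) :=
  ∑ I ∈ B, simplexFace I

open Classical in
/-- The graphical building set `B(Γ)`: all `I ⊆ V` for which the induced graph `Γ|_I` is
connected; in Mathlib a connected graph is nonempty, so the members are nonempty sets. -/
noncomputable def graphicalBuildingSet {V : Type*} [Fintype V] (G : SimpleGraph V) :
    Finset (Finset V) :=
  Finset.univ.filter fun I : Finset V => (G.induce (I : Set V)).Connected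

/-- The graph-associahedron `P_{B(Γ)}`. -/
noncomputable def graphAssociahedron {V : Type*} [Fintype V] [DecidableEq V]
    (G : SimpleGraph V) : Set (V → ℝ) :=
  hypergraphPolytope (graphicalBuildingSet G)

/-- The number of vertices `f_0(P)` of a polytope `P` in `ℝ^V`. -/
noncomputable def numVertices {V : Type*} (P : Set (V → ℝ)) : ℕ :=
  (P.extremePoints ℝ).ncard

/-- The permutohedron `Pe^{n-1}`, from the complete graph `K_n`. -/
noncomputable def permutohedron (n : ℕ) : Set (Fin n → ℝ) :=
  graphAssociahedron (SimpleGraph.completeGraph (Fin n))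

/-- The associahedron `As^{n-1}`, from the path graph `L_n`. -/
noncomputable def associahedron (n : ℕ) : Set (Fin n → ℝ) :=
  graphAssociahedron (SimpleGraph.pathGraph n)

/-- The cyclohedron `Cy^{n-1}`, from the cycle graph `C_n`
(where `C_1` is a point and `C_2` is a single edge). -/
noncomputable def cyclohedron (n : ℕ) : Set (Fin n → ℝ) :=
  graphAssociahedron (SimpleGraph.cycleGraph n)

/-- The star graph `K_{1,n-1}` on `n` vertices, with centre the vertex of value `0`. -/
def starOn (n : ℕ) : SimpleGraph (Fin n) where
  Adj i j := i ≠ j ∧ (i.val = 0 ∨ j.val = 0)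
  symm := ⟨fun _ _ h => ⟨h.1.symm, h.2.symm⟩⟩
  loopless := ⟨fun _ h => h.1 rfl⟩

/-- The stellohedron `St^{n-1}`, from the star graph `K_{1,n-1}`. -/
noncomputable def stellohedron (n : ℕ) : Set (Fin n → ℝ) :=
  graphAssociahedron (starOn n)

/-! A generic linear functional is maximised on a Minkowski sum at the sum of the maximisers on the
summands. On a sum of simplex faces these are basis vectors, so the vertices are the vectors
counting, for each `i`, the members of `B` whose heaviest element is `i`, over all injective weights
(`extremePoints_hypergraphPolytope`). Counting vertices becomes counting the distinct vectors
produced by orderings.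

For a graphical building set this count has two rules. On a connected set `S` the heaviest vertex
`v` is the top of every tube containing it, and the vector determines `v`; hence the count is the
sum over `v` of the counts for `S.erase v` (`card_orderVectors_of_connected`). On a union of two
sets with no edges between them the count is a product (`card_orderVectors_union`).

Deleting a vertex turns a complete graph into a smaller one, a path into two paths, a cycle into a
path, and a star into a smaller star or an independent set. This gives the four recursions; the
closed forms are factorial, Catalan and partial-exponential-sum identities. -/

/-! ### Vertices of Minkowski sums of simplex faces -/

section Geometry

/-- Every real function on a finite type is weakly increasing for some injective weight. -/
theorem exists_injective_weight {V : Type*} [Fintype V] (c : V → ℝ) :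
    ∃ w : V → ℕ, Function.Injective w ∧ ∀ i j, w i ≤ w j → c i ≤ c j := by
  let e := Fintype.equivFin V
  let s := Tuple.sort (c ∘ e.symm)
  have hs : Monotone ((c ∘ e.symm) ∘ s) := Tuple.monotone_sort _
  refine ⟨fun i => (s.symm (e i)).val, fun i j hij => ?_, fun i j hij => ?_⟩
  · exact e.injective (s.symm.injective (Fin.ext hij))
  · have := hs (show s.symm (e i) ≤ s.symm (e j) from hij)
    simpa using this

theorem exists_top {V : Type*} {B : Finset (Finset V)} (hB : ∀ I ∈ B, I.Nonempty) (w : V → ℕ) :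
    ∃ t : (I : Finset V) → I ∈ B → V,
      ∀ I (hI : I ∈ B), t I hI ∈ I ∧ ∀ j ∈ I, w j ≤ w (t I hI) := by
  have h : ∀ (I : Finset V) (_ : I ∈ B), ∃ i, i ∈ I ∧ ∀ j ∈ I, w j ≤ w i := fun I hI =>
    Finset.exists_max_image I w (hB I hI)
  choose t ht using h
  exact ⟨t, ht⟩

variable {V : Type*} [DecidableEq V]

/-- The members of `B` whose largest element with respect to the weight `w` is `i`. -/
def topSet (B : Finset (Finset V)) (w : V → ℕ) (i : V) : Finset (Finset V) :=
  B.filter fun I => i ∈ I ∧ ∀ j ∈ I, w j ≤ w i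

theorem mem_topSet {B : Finset (Finset V)} {w : V → ℕ} {i : V} {I : Finset V} :
    I ∈ topSet B w i ↔ I ∈ B ∧ i ∈ I ∧ ∀ j ∈ I, w j ≤ w i :=
  Finset.mem_filter

/-- The number of members of `B` whose largest element with respect to the weight `w` is `i`. -/
def topCount (B : Finset (Finset V)) (w : V → ℕ) (i : V) : ℕ :=
  (topSet B w i).card

/-- For an injective weight `w`, the vector of top counts is the sum over `I ∈ B` of the basis
vectors of the largest elements of the `I`. -/
theorem topCount_eq_sum_single {B : Finset (Finset V)} {w : V → ℕ} (hw : Function.Injective w)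
    {t : (I : Finset V) → I ∈ B → V}
    (ht : ∀ I (hI : I ∈ B), t I hI ∈ I ∧ ∀ j ∈ I, w j ≤ w (t I hI)) :
    (fun i => (topCount B w i : ℝ)) = ∑ I ∈ B.attach, Pi.single (t I.1 I.2) (1 : ℝ) := by
  funext i
  rw [Finset.sum_apply, topCount, topSet, Finset.card_filter, Nat.cast_sum, ← Finset.sum_attach]
  refine Finset.sum_congr rfl fun I _ => ?_
  obtain ⟨h1, h2⟩ := ht I.1 I.2
  by_cases h : i = t I.1 I.2
  · subst h
    simp only [h1, true_and]
    rw [if_pos h2]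
    simp
  · rw [if_neg, Pi.single_eq_of_ne h, Nat.cast_zero]
    rintro ⟨hi, hmax⟩
    exact h (hw (le_antisymm (h2 i hi) (hmax _ h1)))

theorem simplexFace_subset [Fintype V] (I : Finset V) :
    simplexFace I ⊆ {x | (∀ i, 0 ≤ x i) ∧ (∀ i ∉ I, x i = 0) ∧ ∑ i, x i = 1} := by
  refine convexHull_min ?_ ?_
  · rintro _ ⟨i, hi, rfl⟩
    refine ⟨fun j => ?_, fun j hj => ?_, by simp⟩
    · by_cases h : j = i
      · subst h; simp
      · simp [Pi.single_eq_of_ne h]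
    · rw [Pi.single_eq_of_ne]
      rintro rfl
      exact hj hi
  · rintro x ⟨hx0, hxI, hx1⟩ y ⟨hy0, hyI, hy1⟩ a b ha hb hab
    refine ⟨fun i => ?_, fun i hi => ?_, ?_⟩
    · have := hx0 i
      have := hy0 i
      simp only [Pi.add_apply, Pi.smul_apply, smul_eq_mul]
      positivity
    · simp [hxI i hi, hyI i hi]
    · simp [Finset.sum_add_distrib, ← Finset.mul_sum, hx1, hy1, hab]

theorem sum_mul_le_of_mem_simplexFace [Fintype V] {I : Finset V} {x : V → ℝ}
    (hx : x ∈ simplexFace I) {c : V → ℝ} {t : V} (ht : ∀ j ∈ I, c j ≤ c t) :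
    ∑ i, c i * x i ≤ c t := by
  obtain ⟨h0, hI, h1⟩ := simplexFace_subset I hx
  calc ∑ i, c i * x i ≤ ∑ i, c t * x i := by
        refine Finset.sum_le_sum fun i _ => ?_
        by_cases hi : i ∈ I
        · exact mul_le_mul_of_nonneg_right (ht i hi) (h0 i)
        · simp [hI i hi]
    _ = c t := by rw [← Finset.mul_sum, h1, mul_one]

/-- The terms `(c t - c i) * x i` are nonnegative with sum at most zero, so each vanishes, and the
strict gap kills every coordinate but `t`. -/
theorem eq_single_of_mem_simplexFace [Fintype V] {I : Finset V} {x : V → ℝ}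
    (hx : x ∈ simplexFace I) {c : V → ℝ} {t : V} (ht : ∀ j ∈ I, j ≠ t → c j < c t)
    (h : c t ≤ ∑ i, c i * x i) : x = Pi.single t 1 := by
  obtain ⟨h0, hI, h1⟩ := simplexFace_subset I hx
  have hnn : ∀ i ∈ Finset.univ, 0 ≤ (c t - c i) * x i := fun i _ => by
    by_cases hi : i ∈ I
    · by_cases hit : i = t
      · simp [hit]
      · exact mul_nonneg (sub_nonneg.2 (ht i hi hit).le) (h0 i)
    · simp [hI i hi]
  have hsum : ∑ i, (c t - c i) * x i = 0 := by
    refine le_antisymm ?_ (Finset.sum_nonneg hnn)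
    simp only [sub_mul, Finset.sum_sub_distrib, ← Finset.mul_sum, h1]
    linarith
  have hz := (Finset.sum_eq_zero_iff_of_nonneg hnn).1 hsum
  have hne : ∀ i, i ≠ t → x i = 0 := fun i hit => by
    by_cases hi : i ∈ I
    · exact (mul_eq_zero.1 (hz i (Finset.mem_univ i))).resolve_left
        (sub_pos.2 (ht i hi hit)).ne'
    · exact hI i hi
  funext i
  by_cases hit : i = t
  · subst hit
    rw [Finset.sum_eq_single i (fun j _ hj => hne j hj) (by simp)] at h1
    simpa using h1
  · rw [hne i hit, Pi.single_eq_of_ne hit]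

theorem topCount_le (B : Finset (Finset V)) (w : V → ℕ) (i : V) : topCount B w i ≤ B.card :=
  Finset.card_filter_le _ _

theorem finite_setOf_topCount [Fintype V] (B : Finset (Finset V)) (P : (V → ℕ) → Prop) :
    {x : V → ℕ | ∃ w, P w ∧ topCount B w = x}.Finite := by
  refine (Set.finite_Icc (0 : V → ℕ) (fun _ => B.card)).subset ?_
  rintro _ ⟨w, -, rfl⟩
  exact ⟨fun _ => Nat.zero_le _, fun i => topCount_le B w i⟩

theorem continuousLinear_apply_eq_sum [Fintype V] (f : StrongDual ℝ (V → ℝ)) (x : V → ℝ) :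
    f x = ∑ i, f (Pi.single i 1) * x i := by
  have := LinearMap.pi_apply_eq_sum_univ (f : (V → ℝ) →ₗ[ℝ] ℝ) x
  simp only [ContinuousLinearMap.coe_coe, smul_eq_mul] at this
  rw [this]
  refine Finset.sum_congr rfl fun i _ => ?_
  rw [mul_comm]
  congr 2
  funext j
  simp [Pi.single_apply, eq_comm]

theorem exists_sum_of_mem_hypergraphPolytope {B : Finset (Finset V)} {x : V → ℝ}
    (hx : x ∈ hypergraphPolytope B) :
    ∃ g : Finset V → V → ℝ, (∀ I ∈ B, g I ∈ simplexFace I) ∧ ∑ I ∈ B.attach, g I.1 = x := by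
  obtain ⟨g, hg, hsum⟩ := (Set.mem_finsetSum _ _ _).1 hx
  exact ⟨g, fun I hI => hg hI, by rw [Finset.sum_attach B g, hsum]⟩

theorem sum_single_mem_hypergraphPolytope {B : Finset (Finset V)}
    {t : (I : Finset V) → I ∈ B → V} (ht : ∀ I (hI : I ∈ B), t I hI ∈ I) :
    ∑ I ∈ B.attach, Pi.single (t I.1 I.2) (1 : ℝ) ∈ hypergraphPolytope B := by
  rw [hypergraphPolytope, ← Finset.sum_attach]
  exact Set.finsetSum_mem_finsetSum _ _ _ fun I _ =>
    subset_convexHull ℝ _ ⟨_, ht I.1 I.2, rfl⟩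

/-- The weight itself, read as a linear functional, exposes the point: injectivity makes its
maximiser on each simplex face unique, and equality of the sums forces equality in every summand. -/
theorem topCount_mem_extremePoints [Fintype V] {B : Finset (Finset V)}
    (hB : ∀ I ∈ B, I.Nonempty) {w : V → ℕ} (hw : Function.Injective w) :
    (fun i => (topCount B w i : ℝ)) ∈ (hypergraphPolytope B).extremePoints ℝ := by
  obtain ⟨t, ht⟩ := exists_top hB w
  rw [topCount_eq_sum_single hw ht]
  apply exposedPoints_subset_extremePoints
  refine ⟨sum_single_mem_hypergraphPolytope fun I hI => (ht I hI).1,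
    ∑ i, (w i : ℝ) • ContinuousLinearMap.proj (R := ℝ) (φ := fun _ : V => ℝ) i, fun y hy => ?_⟩
  set l : StrongDual ℝ (V → ℝ) :=
    ∑ i, (w i : ℝ) • ContinuousLinearMap.proj (R := ℝ) (φ := fun _ : V => ℝ) i
  have hl : ∀ x, l x = ∑ i, (w i : ℝ) * x i := fun x => by
    simp [l]
  obtain ⟨g, hg, rfl⟩ := exists_sum_of_mem_hypergraphPolytope hy
  have hle : ∀ I : B, l (g I.1) ≤ w (t I.1 I.2) := fun I => by
    rw [hl]
    exact sum_mul_le_of_mem_simplexFace (c := fun i => (w i : ℝ)) (hg I.1 I.2)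
      fun j hj => Nat.cast_le.2 ((ht I.1 I.2).2 j hj)
  have hs : ∀ i, l (Pi.single i 1) = w i := fun i => by
    rw [hl]
    simp [Pi.single_apply]
  simp only [map_sum, hs]
  refine ⟨Finset.sum_le_sum fun I _ => hle I, fun h => ?_⟩
  have heq := (Finset.sum_eq_sum_iff_of_le fun I _ => hle I).1
    (le_antisymm (Finset.sum_le_sum fun I _ => hle I) h)
  refine Finset.sum_congr rfl fun I hI => ?_
  refine eq_single_of_mem_simplexFace (c := fun i => (w i : ℝ)) (hg I.1 I.2)
    (fun j hj hne => ?_) ?_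
  · exact Nat.cast_lt.2 (lt_of_le_of_ne ((ht I.1 I.2).2 j hj) (hw.ne hne))
  · rw [← hl, heq I hI]

theorem hypergraphPolytope_subset_convexHull [Fintype V] {B : Finset (Finset V)}
    (hB : ∀ I ∈ B, I.Nonempty) :
    hypergraphPolytope B ⊆ convexHull ℝ ((fun (x : V → ℕ) i => (x i : ℝ)) ''
      {x | ∃ w, Function.Injective w ∧ topCount B w = x}) := by
  intro x hx
  by_contra hcon
  obtain ⟨f, u, hf, hu⟩ := geometric_hahn_banach_closed_point (convex_convexHull ℝ _)
    (((finite_setOf_topCount B _).image _).isCompact_convexHull ℝ).isClosed hcon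
  -- The separating functional may have ties; an injective weight refining its order still picks a
  -- maximiser on every face.
  obtain ⟨w, hw, hmono⟩ := exists_injective_weight fun i => f (Pi.single i 1)
  obtain ⟨t, ht⟩ := exists_top hB w
  have h1 := hf _ (subset_convexHull ℝ _ ⟨_, ⟨w, hw, rfl⟩, rfl⟩)
  beta_reduce at h1
  rw [topCount_eq_sum_single hw ht, map_sum] at h1
  obtain ⟨g, hg, rfl⟩ := exists_sum_of_mem_hypergraphPolytope hx
  rw [map_sum] at hu
  refine absurd (h1.trans hu) (not_lt.2 (Finset.sum_le_sum fun I _ => ?_))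
  rw [continuousLinear_apply_eq_sum]
  exact sum_mul_le_of_mem_simplexFace (c := fun i => f (Pi.single i 1)) (hg I.1 I.2)
    fun j hj => hmono _ _ ((ht I.1 I.2).2 j hj)

/-- The vertices of `P_B` are the vectors of top counts of the injective weights. -/
theorem extremePoints_hypergraphPolytope [Fintype V] {B : Finset (Finset V)}
    (hB : ∀ I ∈ B, I.Nonempty) :
    (hypergraphPolytope B).extremePoints ℝ = (fun (x : V → ℕ) i => (x i : ℝ)) ''
      {x | ∃ w, Function.Injective w ∧ topCount B w = x} := by
  apply Set.Subset.antisymm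
  · have hconv : hypergraphPolytope B = convexHull ℝ ((fun (x : V → ℕ) i => (x i : ℝ)) ''
        {x | ∃ w, Function.Injective w ∧ topCount B w = x}) := by
      refine (hypergraphPolytope_subset_convexHull hB).antisymm (convexHull_min ?_ ?_)
      · rintro _ ⟨_, ⟨w, hw, rfl⟩, rfl⟩
        exact (topCount_mem_extremePoints hB hw).1
      · exact convex_sum _ fun I _ => convex_convexHull ℝ _
    rw [hconv]
    exact extremePoints_convexHull_subset
  · rintro _ ⟨_, ⟨w, hw, rfl⟩, rfl⟩
    exact topCount_mem_extremePoints hB hw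

theorem numVertices_hypergraphPolytope [Fintype V] {B : Finset (Finset V)}
    (hB : ∀ I ∈ B, I.Nonempty) :
    numVertices (hypergraphPolytope B) =
      {x | ∃ w, Function.Injective w ∧ topCount B w = x}.ncard := by
  rw [numVertices, extremePoints_hypergraphPolytope hB, Set.ncard_image_of_injective]
  intro x y h
  funext i
  exact Nat.cast_injective (congrFun h i)

end Geometry

/-! ### Recursion for the vectors of top counts of tubes -/

section Recursion

theorem topCount_congr {V : Type*} [DecidableEq V] {B : Finset (Finset V)} {w w' : V → ℕ}
    {S : Finset V} (hB : ∀ I ∈ B, I ⊆ S)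
    (h : ∀ i ∈ S, ∀ j ∈ S, (w i ≤ w j ↔ w' i ≤ w' j)) : topCount B w = topCount B w' := by
  funext i
  refine congrArg Finset.card (Finset.filter_congr fun I hI => and_congr_right fun hi => ?_)
  exact forall₂_congr fun j hj => h j (hB I hI hj) i (hB I hI hi)

theorem topCount_eq_zero {V : Type*} [DecidableEq V] {B : Finset (Finset V)} {w : V → ℕ}
    {S : Finset V} (hB : ∀ I ∈ B, I ⊆ S) {i : V} (hi : i ∉ S) : topCount B w i = 0 :=
  Finset.card_eq_zero.2 (Finset.filter_eq_empty_iff.2 fun I hI h => hi (hB I hI h.1))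

theorem topCount_union {V : Type*} [DecidableEq V] {B C : Finset (Finset V)}
    (h : Disjoint B C) (w : V → ℕ) : topCount (B ∪ C) w = topCount B w + topCount C w := by
  funext i
  rw [Pi.add_apply, topCount, topSet, Finset.filter_union,
    Finset.card_union_of_disjoint (Finset.disjoint_filter_filter h)]
  rfl

variable {V : Type*} (G : SimpleGraph V)

open Classical in
/-- The subsets of `S` that induce a connected subgraph of `G`. -/
noncomputable def tubes (S : Finset V) : Finset (Finset V) :=
  S.powerset.filter fun I => (G.induce (I : Set V)).Connected

variable {G}

theorem mem_tubes {S I : Finset V} :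
    I ∈ tubes G S ↔ I ⊆ S ∧ (G.induce (I : Set V)).Connected := by
  simp [tubes]

theorem tubes_subset {S I : Finset V} (hI : I ∈ tubes G S) : I ⊆ S := (mem_tubes.1 hI).1

theorem tubes_mono {S T : Finset V} (h : S ⊆ T) : tubes G S ⊆ tubes G T := fun _ hI =>
  mem_tubes.2 ⟨(tubes_subset hI).trans h, (mem_tubes.1 hI).2⟩

theorem nonempty_of_mem_tubes {S I : Finset V} (hI : I ∈ tubes G S) : I.Nonempty := by
  obtain ⟨⟨i, hi⟩⟩ := (mem_tubes.1 hI).2.nonempty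
  exact ⟨i, hi⟩

theorem graphicalBuildingSet_eq_tubes [Fintype V] : graphicalBuildingSet G = tubes G .univ := by
  ext I
  simp [graphicalBuildingSet, tubes]

/-- A connected induced subgraph of a separated union lies on one side. -/
theorem subset_or_subset_of_connected [DecidableEq V] {S T I : Finset V}
    (hadj : ∀ i ∈ S, ∀ j ∈ T, ¬ G.Adj i j)
    (hI : I ⊆ S ∪ T) (hc : (G.induce (I : Set V)).Connected) : I ⊆ S ∨ I ⊆ T := by
  by_contra! hcon
  obtain ⟨j, hj, hjS⟩ := Finset.not_subset.1 hcon.1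
  obtain ⟨i, hi, hiT⟩ := Finset.not_subset.1 hcon.2
  have hiS : i ∈ S := (Finset.mem_union.1 (hI hi)).resolve_right hiT
  have key : ∀ (u v : (I : Set V)), (G.induce (I : Set V)).Walk u v → u.1 ∈ S → v.1 ∈ S := by
    intro u v p
    induction p with
    | nil => exact id
    | @cons a b _ h _ ih =>
      intro ha
      refine ih ?_
      by_contra hb
      exact hadj _ ha _ ((Finset.mem_union.1 (hI b.2)).resolve_left hb) h
  obtain ⟨p⟩ := hc.preconnected ⟨i, hi⟩ ⟨j, hj⟩
  exact hjS (key _ _ p hiS)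

theorem tubes_union [DecidableEq V] {S T : Finset V} (hadj : ∀ i ∈ S, ∀ j ∈ T, ¬ G.Adj i j) :
    tubes G (S ∪ T) = tubes G S ∪ tubes G T := by
  refine Finset.Subset.antisymm (fun I hI => ?_) (Finset.union_subset
    (tubes_mono Finset.subset_union_left) (tubes_mono Finset.subset_union_right))
  obtain ⟨h, hc⟩ := mem_tubes.1 hI
  exact Finset.mem_union.2 ((subset_or_subset_of_connected hadj h hc).imp
    (fun h => mem_tubes.2 ⟨h, hc⟩) fun h => mem_tubes.2 ⟨h, hc⟩)

theorem disjoint_tubes {S T : Finset V} (h : Disjoint S T) :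
    Disjoint (tubes G S) (tubes G T) := by
  refine Finset.disjoint_left.2 fun I hS hT => ?_
  obtain ⟨i, hi⟩ := nonempty_of_mem_tubes hS
  exact Finset.disjoint_left.1 h (tubes_subset hS hi) (tubes_subset hT hi)

/-- If `v` has the largest weight in `S`, then `v` is the top of every tube that contains it. -/
theorem topCount_tubes_eq_update [DecidableEq V] {S : Finset V} {w : V → ℕ} (hw : Set.InjOn w S) {v : V}
    (hv : v ∈ S) (hmax : ∀ j ∈ S, w j ≤ w v) :
    topCount (tubes G S) w = Function.update (topCount (tubes G (S.erase v)) w) v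
      ((tubes G S).filter (v ∈ ·)).card := by
  funext i
  by_cases hi : i = v
  · subst hi
    rw [Function.update_self]
    refine congrArg Finset.card (Finset.ext fun I => ?_)
    rw [mem_topSet, Finset.mem_filter]
    exact ⟨fun h => ⟨h.1, h.2.1⟩, fun h => ⟨h.1, h.2, fun j hj => hmax j (tubes_subset h.1 hj)⟩⟩
  · rw [Function.update_of_ne hi]
    refine congrArg Finset.card (Finset.ext fun I => ?_)
    simp only [mem_topSet, mem_tubes, Finset.subset_erase]
    refine ⟨fun ⟨⟨hS, hc⟩, hiI, h⟩ => ⟨⟨⟨hS, fun hvI => ?_⟩, hc⟩, hiI, h⟩,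
      fun ⟨⟨⟨hS, _⟩, hc⟩, hiI, h⟩ => ⟨⟨hS, hc⟩, hiI, h⟩⟩
    exact hi (hw (hS hiI) hv (le_antisymm (hmax i (hS hiI)) (h v hvI)))

variable [Fintype V] [DecidableEq V] (G)

/-- The vectors of top counts of the connected subsets of `S`, over all orders on `S`. -/
noncomputable def orderVectors (S : Finset V) : Finset (V → ℕ) :=
  (finite_setOf_topCount (tubes G S) fun w => Set.InjOn w S).toFinset

variable {G}

theorem mem_orderVectors {S : Finset V} {x : V → ℕ} :
    x ∈ orderVectors G S ↔ ∃ w, Set.InjOn w S ∧ topCount (tubes G S) w = x := by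
  simp [orderVectors]

theorem numVertices_graphAssociahedron :
    numVertices (graphAssociahedron G) = (orderVectors G .univ).card := by
  rw [graphAssociahedron, graphicalBuildingSet_eq_tubes,
    numVertices_hypergraphPolytope fun I hI => nonempty_of_mem_tubes hI, ← Set.ncard_coe_finset]
  congr 1
  ext x
  simp [mem_orderVectors, Set.injOn_univ]

theorem orderVectors_apply_eq_zero {S : Finset V} {x : V → ℕ} (hx : x ∈ orderVectors G S)
    {i : V} (hi : i ∉ S) : x i = 0 := by
  obtain ⟨w, -, rfl⟩ := mem_orderVectors.1 hx
  exact topCount_eq_zero (fun I hI => tubes_subset hI) hi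

theorem card_orderVectors_empty : (orderVectors G ∅).card = 1 := by
  refine Finset.card_eq_one.2 ⟨0, Finset.eq_singleton_iff_unique_mem.2 ⟨?_, ?_⟩⟩
  · refine mem_orderVectors.2 ⟨0, by simp, ?_⟩
    funext i
    exact topCount_eq_zero (fun I hI => tubes_subset hI) (Finset.notMem_empty i)
  · intro x hx
    funext i
    exact orderVectors_apply_eq_zero hx (Finset.notMem_empty i)

theorem orderVectors_eq_biUnion {S : Finset V} (hS : S.Nonempty) :
    orderVectors G S = S.biUnion fun v => (orderVectors G (S.erase v)).image fun y =>
      Function.update y v ((tubes G S).filter (v ∈ ·)).card := by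
  ext x
  simp only [Finset.mem_biUnion, Finset.mem_image, mem_orderVectors]
  constructor
  · rintro ⟨w, hw, rfl⟩
    obtain ⟨v, hv, hmax⟩ := Finset.exists_max_image S w hS
    refine ⟨v, hv, _, ⟨w, hw.mono (Finset.coe_subset.2 (Finset.erase_subset v S)), rfl⟩, ?_⟩
    exact (topCount_tubes_eq_update hw hv hmax).symm
  · rintro ⟨v, hv, _, ⟨w, hw, rfl⟩, rfl⟩
    -- Raising `v` to `S.sup w + 1` puts it above all of `S` and keeps the order on the rest.
    have hlt : ∀ j ∈ S, w j < S.sup w + 1 := fun j hj => Nat.lt_succ_of_le (Finset.le_sup hj)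
    have hne : ∀ j ∈ S, j ≠ v → Function.update w v (S.sup w + 1) j = w j := fun j _ h =>
      Function.update_of_ne h _ _
    have hinj : Set.InjOn (Function.update w v (S.sup w + 1)) S := by
      intro i hi j hj hij
      by_cases h1 : i = v <;> by_cases h2 : j = v
      · rw [h1, h2]
      · rw [h1, Function.update_self, hne j hj h2] at hij
        exact absurd hij (hlt j hj).ne'
      · rw [h2, Function.update_self, hne i hi h1] at hij
        exact absurd hij (hlt i hi).ne
      · rw [hne i hi h1, hne j hj h2] at hij
        exact hw (by simpa [h1] using hi) (by simpa [h2] using hj) hij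
    refine ⟨_, hinj, ?_⟩
    rw [topCount_tubes_eq_update hinj hv]
    · congr 1
      refine topCount_congr (fun I hI => tubes_subset hI) fun i hi j hj => ?_
      rw [Finset.mem_erase] at hi hj
      rw [hne i hi.2 hi.1, hne j hj.2 hj.1]
    · intro j hj
      by_cases h : j = v
      · rw [h]
      · rw [hne j hj h, Function.update_self]
        exact (hlt j hj).le

/-- The number of order vectors of a connected set is the sum over the possible largest
elements. -/
theorem card_orderVectors_of_connected {S : Finset V} (hS : (G.induce (S : Set V)).Connected) :
    (orderVectors G S).card = ∑ v ∈ S, (orderVectors G (S.erase v)).card := by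
  have hmem : S ∈ tubes G S := mem_tubes.2 ⟨subset_rfl, hS⟩
  rw [orderVectors_eq_biUnion (nonempty_of_mem_tubes hmem), Finset.card_biUnion]
  · refine Finset.sum_congr rfl fun v _ => Finset.card_image_of_injOn ?_
    intro y hy z hz h
    funext i
    by_cases hi : i = v
    · subst hi
      rw [orderVectors_apply_eq_zero hy (Finset.notMem_erase i S),
        orderVectors_apply_eq_zero hz (Finset.notMem_erase i S)]
    · simpa [Function.update_of_ne hi] using congrFun h i
  · intro v hv u hu hvu
    refine Finset.disjoint_left.2 fun x hx hx' => ?_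
    obtain ⟨y, hy, rfl⟩ := Finset.mem_image.1 hx
    obtain ⟨z, -, h⟩ := Finset.mem_image.1 hx'
    -- If `u` is on top, coordinate `u` counts all tubes containing `u`; if `v` is on top, it misses
    -- at least the tube `S`.
    have h := congrFun h u
    rw [Function.update_self, Function.update_of_ne hvu.symm] at h
    obtain ⟨w, -, rfl⟩ := mem_orderVectors.1 hy
    refine absurd h (ne_of_gt (Finset.card_lt_card ((Finset.ssubset_iff_of_subset ?_).2
      ⟨S, Finset.mem_filter.2 ⟨hmem, hu⟩, ?_⟩)))
    · intro I hI
      rw [mem_topSet] at hI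
      rw [Finset.mem_filter]
      exact ⟨tubes_mono (Finset.erase_subset v S) hI.1, hI.2.1⟩
    · intro hSv
      exact Finset.notMem_erase v S (tubes_subset (mem_topSet.1 hSv).1 hv)

theorem orderVectors_union {S T : Finset V} (hST : Disjoint S T)
    (hadj : ∀ i ∈ S, ∀ j ∈ T, ¬ G.Adj i j) :
    orderVectors G (S ∪ T) =
      (orderVectors G S ×ˢ orderVectors G T).image fun y => y.1 + y.2 := by
  ext x
  simp only [Finset.mem_image, Finset.mem_product, Prod.exists, mem_orderVectors,
    tubes_union hadj, topCount_union (disjoint_tubes hST)]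
  constructor
  · rintro ⟨w, hw, rfl⟩
    exact ⟨_, _, ⟨⟨w, hw.mono (by simp), rfl⟩, ⟨w, hw.mono (by simp), rfl⟩⟩, rfl⟩
  · rintro ⟨_, _, ⟨⟨w, hw, rfl⟩, ⟨w', hw', rfl⟩⟩, rfl⟩
    -- Placing `T` above `S` is an arbitrary choice: no tube meets both sides, so only the order
    -- within each side matters.
    let u : V → ℕ := fun i => if i ∈ S then w i else S.sup w + 1 + w' i
    have huS : ∀ i ∈ S, u i = w i := fun i hi => if_pos hi
    have huT : ∀ i ∈ T, u i = S.sup w + 1 + w' i := fun i hi =>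
      if_neg (Finset.disjoint_right.1 hST hi)
    have hlt : ∀ i ∈ S, w i < S.sup w + 1 := fun i hi => Nat.lt_succ_of_le (Finset.le_sup hi)
    refine ⟨u, fun i hi j hj hij => ?_, ?_⟩
    · rw [Finset.mem_coe, Finset.mem_union] at hi hj
      rcases hi with hi | hi <;> rcases hj with hj | hj
      · rw [huS i hi, huS j hj] at hij
        exact hw hi hj hij
      · rw [huS i hi, huT j hj] at hij
        have := hlt i hi
        omega
      · rw [huT i hi, huS j hj] at hij
        have := hlt j hj
        omega
      · rw [huT i hi, huT j hj] at hij
        exact hw' hi hj (by omega)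
    · congr 1
      · refine topCount_congr (fun I hI => tubes_subset hI) fun i hi j hj => ?_
        rw [huS i hi, huS j hj]
      · refine topCount_congr (fun I hI => tubes_subset hI) fun i hi j hj => ?_
        rw [huT i hi, huT j hj]
        omega

/-- The number of order vectors is multiplicative over separated unions. -/
theorem card_orderVectors_union {S T : Finset V} (hST : Disjoint S T)
    (hadj : ∀ i ∈ S, ∀ j ∈ T, ¬ G.Adj i j) :
    (orderVectors G (S ∪ T)).card = (orderVectors G S).card * (orderVectors G T).card := by
  rw [orderVectors_union hST hadj, Finset.card_image_of_injOn, Finset.card_product]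
  rintro ⟨y, z⟩ hyz ⟨y', z'⟩ hyz' h
  rw [Finset.mem_coe, Finset.mem_product] at hyz hyz'
  have hi : ∀ i, y i = y' i ∧ z i = z' i := fun i => by
    have h := congrFun h i
    simp only [Pi.add_apply] at h
    by_cases hS : i ∈ S
    · have hT := Finset.disjoint_left.1 hST hS
      have h1 := orderVectors_apply_eq_zero hyz.2 hT
      have h2 := orderVectors_apply_eq_zero hyz'.2 hT
      dsimp only at h1 h2
      omega
    · have h1 := orderVectors_apply_eq_zero hyz.1 hS
      have h2 := orderVectors_apply_eq_zero hyz'.1 hS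
      dsimp only at h1 h2
      omega
  exact Prod.ext (funext fun i => (hi i).1) (funext fun i => (hi i).2)

end Recursion

/-! ### Complete graphs, stars and paths -/

section Families

theorem connected_induce_of_universal {V : Type*} {G : SimpleGraph V} {S : Finset V} {c : V}
    (hc : c ∈ S) (h : ∀ j ∈ S, c ≠ j → G.Adj c j) : (G.induce (S : Set V)).Connected :=
  SimpleGraph.Connected.of_isUniversal (v := ⟨c, hc⟩) fun j hj =>
    h j.1 j.2 fun hcj => hj (Subtype.ext hcj)

/-- Adjacency is prescribed only for indices below `m`, so that arcs of a cycle are covered as well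
as intervals of a path. -/
theorem connected_induce_of_path {V : Type*} [DecidableEq V] {G : SimpleGraph V} {f : ℕ → V} {m : ℕ}
    (hadj : ∀ i < m, ∀ j < m, (G.Adj (f i) (f j) ↔ i + 1 = j ∨ j + 1 = i)) {a k : ℕ}
    (hak : a + (k + 1) ≤ m) :
    (G.induce (((Finset.Ico a (a + (k + 1))).image f : Finset V) : Set V)).Connected := by
  have hmem : ∀ i : Fin (k + 1), f (a + i) ∈
      (((Finset.Ico a (a + (k + 1))).image f : Finset V) : Set V) := fun i =>
    Finset.mem_coe.2 (Finset.mem_image_of_mem f (Finset.mem_Ico.2 (by omega)))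
  refine (SimpleGraph.pathGraph_connected k).map
    (G := SimpleGraph.pathGraph (k + 1)) ⟨fun i => ⟨f (a + i), hmem i⟩, ?_⟩ ?_
  · intro i j hij
    rw [SimpleGraph.pathGraph_adj] at hij
    exact (hadj _ (by omega) _ (by omega)).2 (by omega)
  · rintro ⟨x, hx⟩
    obtain ⟨i, hi, rfl⟩ := Finset.mem_image.1 (Finset.mem_coe.1 hx)
    rw [Finset.mem_Ico] at hi
    exact ⟨⟨i - a, by omega⟩, Subtype.ext (congrArg f (by simp; omega))⟩

variable {V : Type*} [Fintype V] [DecidableEq V] {G : SimpleGraph V}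

theorem card_orderVectors_of_complete {S : Finset V}
    (h : ∀ i ∈ S, ∀ j ∈ S, i ≠ j → G.Adj i j) : (orderVectors G S).card = S.card.factorial := by
  induction hn : S.card generalizing S with
  | zero =>
    rw [Finset.card_eq_zero.1 hn, card_orderVectors_empty, Nat.factorial_zero]
  | succ n ih =>
    obtain ⟨c, hc⟩ := Finset.card_pos.1 (show 0 < S.card by omega)
    rw [card_orderVectors_of_connected (connected_induce_of_universal hc (h c hc)),
      Finset.sum_congr rfl fun v hv => ih
        (fun i hi j hj => h i (Finset.mem_of_mem_erase hi) j (Finset.mem_of_mem_erase hj))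
        (by rw [Finset.card_erase_of_mem hv, hn, Nat.add_sub_cancel]),
      Finset.sum_const, hn, smul_eq_mul, Nat.factorial_succ]

theorem card_orderVectors_singleton (v : V) : (orderVectors G {v}).card = 1 := by
  rw [card_orderVectors_of_complete (by simp), Finset.card_singleton, Nat.factorial_one]

theorem card_orderVectors_of_independent {S : Finset V}
    (h : ∀ i ∈ S, ∀ j ∈ S, ¬ G.Adj i j) : (orderVectors G S).card = 1 := by
  induction S using Finset.induction_on with
  | empty => exact card_orderVectors_empty
  | insert v S hv ih =>
    rw [Finset.insert_eq, card_orderVectors_union (Finset.disjoint_singleton_left.2 hv),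
      card_orderVectors_singleton, ih, one_mul]
    · exact fun i hi j hj => h i (Finset.mem_insert_of_mem hi) j (Finset.mem_insert_of_mem hj)
    · intro i hi j hj
      exact h i (Finset.mem_singleton.1 hi ▸ Finset.mem_insert_self v S) j
        (Finset.mem_insert_of_mem hj)

/-- The number of order vectors of a star with `n` leaves. -/
def starCount : ℕ → ℕ
  | 0 => 1
  | n + 1 => (n + 1) * starCount n + 1

/-- Deleting a leaf leaves a star with one leaf fewer; deleting the centre leaves an independent
set, which contributes the `+ 1`. -/
theorem card_orderVectors_of_star {c : V} (hG : ∀ i j, G.Adj i j ↔ i ≠ j ∧ (i = c ∨ j = c))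
    {S : Finset V} (hc : c ∈ S) {n : ℕ} (hn : S.card = n + 1) :
    (orderVectors G S).card = starCount n := by
  induction n generalizing S with
  | zero =>
    obtain ⟨v, rfl⟩ := Finset.card_eq_one.1 hn
    exact card_orderVectors_singleton v
  | succ n ih =>
    rw [card_orderVectors_of_connected
      (connected_induce_of_universal hc fun j _ h => (hG c j).2 ⟨h, Or.inl rfl⟩),
      ← Finset.sum_erase_add _ _ hc, card_orderVectors_of_independent,
      Finset.sum_congr rfl fun v hv => ih
        (Finset.mem_erase.2 ⟨(Finset.ne_of_mem_erase hv).symm, hc⟩)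
        (by rw [Finset.card_erase_of_mem (Finset.mem_of_mem_erase hv), hn, Nat.add_sub_cancel]),
      Finset.sum_const, Finset.card_erase_of_mem hc, hn, smul_eq_mul, Nat.add_sub_cancel]
    · rfl
    · intro i hi j hj hij
      rcases ((hG i j).1 hij).2 with rfl | rfl
      · exact Finset.notMem_erase _ _ hi
      · exact Finset.notMem_erase _ _ hj

/-- Deleting the vertex at offset `i` leaves separated intervals of lengths `i` and `k - i`, where
`k + 1` is the full length: this is the Catalan recursion. -/
theorem card_orderVectors_of_path {f : ℕ → V} {m : ℕ} (hf : ∀ i < m, ∀ j < m, f i = f j → i = j)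
    (hadj : ∀ i < m, ∀ j < m, (G.Adj (f i) (f j) ↔ i + 1 = j ∨ j + 1 = i)) {k a : ℕ}
    (hak : a + k ≤ m) :
    (orderVectors G ((Finset.Ico a (a + k)).image f)).card = catalan k := by
  induction k using Nat.strong_induction_on generalizing a with
  | _ k ih =>
  rcases k with _ | k
  · simp [card_orderVectors_empty]
  rw [card_orderVectors_of_connected (connected_induce_of_path hadj hak), Finset.sum_image,
    Finset.sum_Ico_eq_sum_range, Nat.add_sub_cancel_left, catalan_succ,
    Fin.sum_univ_eq_sum_range (fun i => catalan i * catalan (k - i)) (k + 1)]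
  · refine Finset.sum_congr rfl fun i hi => ?_
    rw [Finset.mem_range] at hi
    have hsplit : ((Finset.Ico a (a + (k + 1))).image f).erase (f (a + i)) =
        (Finset.Ico a (a + i)).image f ∪
          (Finset.Ico (a + i + 1) (a + i + 1 + (k - i))).image f := by
      ext x
      simp only [Finset.mem_erase, Finset.mem_union, Finset.mem_image, Finset.mem_Ico]
      constructor
      · rintro ⟨hne, j, hj, rfl⟩
        have : j ≠ a + i := fun h => hne (h ▸ rfl)
        rcases lt_or_gt_of_ne this with h | h
        · exact Or.inl ⟨j, by omega, rfl⟩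
        · exact Or.inr ⟨j, by omega, rfl⟩
      · rintro (⟨j, hj, rfl⟩ | ⟨j, hj, rfl⟩)
        · exact ⟨fun h => absurd (hf _ (by omega) _ (by omega) h) (by omega), j, by omega, rfl⟩
        · exact ⟨fun h => absurd (hf _ (by omega) _ (by omega) h) (by omega), j, by omega, rfl⟩
    rw [hsplit, card_orderVectors_union, ih i hi (by omega), ih (k - i) (by omega) (by omega)]
    · refine Finset.disjoint_left.2 fun x hx hx' => ?_
      obtain ⟨j, hj, rfl⟩ := Finset.mem_image.1 hx
      obtain ⟨l, hl, h⟩ := Finset.mem_image.1 hx'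
      rw [Finset.mem_Ico] at hj hl
      exact absurd (hf _ (by omega) _ (by omega) h) (by omega)
    · intro x hx y hy
      obtain ⟨j, hj, rfl⟩ := Finset.mem_image.1 hx
      obtain ⟨l, hl, rfl⟩ := Finset.mem_image.1 hy
      rw [Finset.mem_Ico] at hj hl
      rw [hadj _ (by omega) _ (by omega)]
      omega
  · intro i hi j hj h
    rw [Finset.mem_coe, Finset.mem_Ico] at hi hj
    exact hf _ (by omega) _ (by omega) h

end Families

/-! ### The four polytopes and closed forms -/

theorem numVertices_permutohedron (n : ℕ) : numVertices (permutohedron n) = n.factorial := by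
  rw [permutohedron, numVertices_graphAssociahedron,
    card_orderVectors_of_complete fun i _ j _ h => h, Finset.card_univ, Fintype.card_fin]

theorem numVertices_associahedron (n : ℕ) : numVertices (associahedron n) = catalan n := by
  rw [associahedron, numVertices_graphAssociahedron]
  rcases n with _ | n
  · rw [Finset.univ_eq_empty, card_orderVectors_empty, catalan_zero]
  have hval : ∀ i < n + 1, (Fin.ofNat (n + 1) i).val = i := fun i hi => Nat.mod_eq_of_lt hi
  have huniv : (Finset.univ : Finset (Fin (n + 1))) =
      (Finset.Ico 0 (0 + (n + 1))).image (Fin.ofNat (n + 1)) := by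
    ext i
    simp only [Finset.mem_univ, Finset.mem_image, Finset.mem_Ico, true_iff]
    exact ⟨i.val, by omega, Fin.ext (hval _ i.isLt)⟩
  rw [huniv, card_orderVectors_of_path (m := n + 1)]
  · intro i hi j hj h
    rw [← hval i hi, h, hval j hj]
  · intro i hi j hj
    rw [SimpleGraph.pathGraph_adj, hval i hi, hval j hj]
  · omega

-- Going round the cycle from `v + 1` lists the other vertices as a path.
open Fin.NatCast Fin.CommRing in
theorem card_orderVectors_cycleGraph_erase (n : ℕ) (v : Fin (n + 1)) :
    (orderVectors (SimpleGraph.cycleGraph (n + 1)) (Finset.univ.erase v)).card = catalan n := by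
  rcases n with _ | n
  · rw [catalan_zero, Fin.fin_one_eq_zero v]
    exact card_orderVectors_empty
  have hinj : ∀ i < n + 2, ∀ j < n + 2, (i : Fin (n + 2)) = (j : Fin (n + 2)) → i = j := by
    intro i hi j hj h
    have := congrArg Fin.val h
    rwa [Fin.val_natCast, Fin.val_natCast, Nat.mod_eq_of_lt hi, Nat.mod_eq_of_lt hj] at this
  have herase : Finset.univ.erase v =
      (Finset.Ico 0 (0 + (n + 1))).image fun i : ℕ => v + 1 + (i : Fin (n + 2)) := by
    have hsub : (Finset.Ico 0 (0 + (n + 1))).image (fun i : ℕ => v + 1 + (i : Fin (n + 2))) ⊆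
        Finset.univ.erase v := by
      intro x hx
      obtain ⟨i, hi, rfl⟩ := Finset.mem_image.1 hx
      rw [Finset.mem_Ico] at hi
      refine Finset.mem_erase.2 ⟨fun h => ?_, Finset.mem_univ _⟩
      have h0 : ((i + 1 : ℕ) : Fin (n + 2)) = ((0 : ℕ) : Fin (n + 2)) := by
        have h := add_eq_left.1 ((add_assoc v 1 _).symm.trans h)
        rw [Nat.cast_add, Nat.cast_one, Nat.cast_zero]
        exact (add_comm _ _).trans h
      exact absurd (hinj _ (by omega) _ (by omega) h0) (by omega)
    refine (Finset.eq_of_subset_of_card_le hsub ?_).symm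
    rw [Finset.card_image_of_injOn, Finset.card_erase_of_mem (Finset.mem_univ v)]
    · simp
    · intro i hi j hj h
      rw [Finset.mem_coe, Finset.mem_Ico] at hi hj
      exact hinj _ (by omega) _ (by omega) (add_left_cancel h)
  rw [herase, card_orderVectors_of_path (m := n + 1)]
  · intro i hi j hj h
    exact hinj _ (by omega) _ (by omega) (add_left_cancel h)
  -- There is no wrap-around: `i` and `j + 1` are both below the modulus `n + 2`.
  · have hsub : ∀ i < n + 1, ∀ j < n + 1,
        ((v + 1 + (i : Fin (n + 2))) - (v + 1 + (j : Fin (n + 2))) = 1 ↔ j + 1 = i) := by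
      intro i hi j hj
      rw [add_sub_add_left_eq_sub, sub_eq_iff_eq_add']
      refine ⟨fun h => (hinj _ (by omega) _ (by omega) ?_).symm, fun h => ?_⟩
      · rw [h, Nat.cast_add, Nat.cast_one]
      · rw [← h, Nat.cast_add, Nat.cast_one]
    intro i hi j hj
    rw [SimpleGraph.cycleGraph_adj, hsub i hi j hj, hsub j hj i hi, or_comm]
  · omega

theorem numVertices_cyclohedron (n : ℕ) :
    numVertices (cyclohedron (n + 1)) = (n + 1) * catalan n := by
  rw [cyclohedron, numVertices_graphAssociahedron, card_orderVectors_of_connected,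
    Finset.sum_congr rfl fun v _ => card_orderVectors_cycleGraph_erase n v, Finset.sum_const,
    Finset.card_univ, Fintype.card_fin, smul_eq_mul]
  rw [Finset.coe_univ]
  exact (SimpleGraph.induceUnivIso _).connected_iff.2 SimpleGraph.cycleGraph_connected

theorem numVertices_stellohedron (n : ℕ) :
    numVertices (stellohedron (n + 1)) = starCount n := by
  rw [stellohedron, numVertices_graphAssociahedron]
  refine card_orderVectors_of_star (c := 0) (fun i j => ?_) (Finset.mem_univ _) (by simp)
  rw [starOn]
  simp only [Fin.ext_iff, Fin.val_zero]

theorem starCount_eq (n : ℕ) :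
    (starCount n : ℚ) = (n.factorial : ℚ) * ∑ k ∈ Finset.range (n + 1), 1 / (k.factorial : ℚ) := by
  induction n with
  | zero => simp [starCount]
  | succ n ih =>
    have h : ((n + 1).factorial : ℚ) ≠ 0 := Nat.cast_ne_zero.2 (Nat.factorial_ne_zero _)
    rw [starCount, Finset.sum_range_succ, mul_add, mul_one_div_cancel h]
    push_cast [Nat.factorial_succ, ih]
    ring

theorem catalan_eq_sum_Icc (n : ℕ) :
    catalan (n + 1) = ∑ k ∈ Finset.Icc 1 (n + 1), catalan (k - 1) * catalan (n + 1 - k) := by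
  rw [catalan_succ, Fin.sum_univ_eq_sum_range (fun i => catalan i * catalan (n - i)) (n + 1),
    ← Finset.Ico_add_one_right_eq_Icc, Finset.sum_Ico_eq_sum_range]
  refine Finset.sum_congr rfl fun i _ => ?_
  congr 2 <;> omega

theorem mainTheorem11
    (p a c s : ℕ → ℕ)
    (hp : ∀ n, p n = numVertices (permutohedron n))
    (ha : ∀ n, a n = numVertices (associahedron n))
    (hc : ∀ n, c n = numVertices (cyclohedron n))
    (hs : ∀ n, s n = numVertices (stellohedron n)) :
    (p 1 = 1 ∧ a 1 = 1 ∧ c 1 = 1 ∧ s 1 = 1) ∧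
    ∀ n : ℕ, 1 ≤ n →
      p n = n * p (n - 1) ∧
      a n = ∑ k ∈ Finset.Icc 1 n, a (k - 1) * a (n - k) ∧
      c n = n * a (n - 1) ∧
      s n = (n - 1) * s (n - 1) + 1 ∧
      p n = n.factorial ∧
      (a n : ℚ) = 1 / ((n : ℚ) + 1) * ((2 * n).choose n : ℚ) ∧
      c n = (2 * n - 2).choose (n - 1) ∧
      (s n : ℚ) = ((n - 1).factorial : ℚ) * ∑ k ∈ Finset.range n, 1 / (k.factorial : ℚ) := by
  have hp' : ∀ n, p n = n.factorial := fun n => (hp n).trans (numVertices_permutohedron n)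
  have ha' : ∀ n, a n = catalan n := fun n => (ha n).trans (numVertices_associahedron n)
  have hc' : ∀ n, c (n + 1) = (n + 1) * catalan n := fun n =>
    (hc _).trans (numVertices_cyclohedron n)
  have hs' : ∀ n, s (n + 1) = starCount n := fun n => (hs _).trans (numVertices_stellohedron n)
  refine ⟨⟨hp' 1, (ha' 1).trans catalan_one, (hc' 0).trans (by simp), hs' 0⟩, fun n hn => ?_⟩
  obtain ⟨n, rfl⟩ := Nat.exists_eq_add_of_le' hn
  simp only [ha', hp', hc', hs', Nat.add_sub_cancel]
  refine ⟨Nat.factorial_succ n, catalan_eq_sum_Icc n, trivial, ?_, trivial, ?_, ?_, starCount_eq n⟩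
  -- For the one-vertex star the factor in front of `s 0` is zero, so the value of `s 0` is
  -- irrelevant.
  · rcases n with _ | n
    · simp [starCount]
    · rw [hs', starCount]
  · have h := succ_mul_catalan_eq_centralBinom (n + 1)
    rw [Nat.centralBinom_eq_two_mul_choose] at h
    rw [← h]
    push_cast
    field_simp
  · rw [succ_mul_catalan_eq_centralBinom, Nat.centralBinom_eq_two_mul_choose]
    congr 1
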